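/- Let $P\subset\mathbb R^d$ be a polytope (the convex hull of a nonempty finite set) with vertex set $V(P)$, and let $c\in\mathbb R^d$ be generic, that is, $c^tu\neq c^tv$ for every edge $uv$ of $P$. Let $v_{\min}$ and $v_{\mathrm{opt}}$ be the vertices of $P$ that minimize, respectively maximize, $c$. A $c$-arborescence is a map $\mathcal A:V(P)\to V(P)$ such that $\mathcal A(v)=v$ if and only if $v=v_{\mathrm{opt}}$, and for every $v\ne v_{\mathrm{opt}}$ the vertex $\mathcal A(v)$ is adjacent to $v$ and $c^t\mathcal A(v)>c^tv$. The max-slope pivot rule polytope is $$\Pi^{\mathrm{MS}}_{P,c}=\mathrm{conv}\Big\{\sum_{v\in V(P),\,v\neq v_{\mathrm{opt}}}\frac{\mathcal A(v)-v}{c^t(\mathcal A(v)-v)}\;:\;\mathcal A\text{ a }c\text{-arborescence}\Big\}.$$ A monotone path is a sequence of vertices $v_{\min}=v_0,v_1,\dots,v_k=v_{\mathrm{opt}}$ in which $v_{i-1}v_i$ is an edge of $P$ and $c^tv_{i-1}<c^tv_i$ for $i=1,\dots,k$. The (Billera–Sturmfels) monotone path polytope is $$\mathrm{Mon}_c(P)=\mathrm{conv}\Big\{\sum_{i=1}^k\frac{c^t(v_i-v_{i-1})}{c^t(v_k-v_0)}\cdot\frac{v_i+v_{i-1}}2\;:\;v_0,\dots,v_k\text{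 a monotone path}\Big\}$$ (an empty sum being $0$). A polytope $Q$ is a weak Minkowski summand of a polytope $P'$ if $\lambda P'=Q+R$ for some $\lambda>0$ and some polytope $R$; two polytopes are normally equivalent if each is a weak Minkowski summand of the other. Theorem. $\mathrm{Mon}_c(P)$ is a weak Minkowski summand of $\Pi^{\mathrm{MS}}_{P,c}$. If, moreover, $P$ is a zonotope, that is, $-t+P=[-z_1,z_1]+\dots+[-z_n,z_n]$ for some $t,z_1,\dots,z_n\in\mathbb R^d$, then $\mathrm{Mon}_c(P)$ and $\Pi^{\mathrm{MS}}_{P,c}$ are normally equivalent. -/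

import Mathlib

open scoped Pointwise

namespace PivotPolytopes

/-- `E d` is `ℝ^d`; the pairing `c^t x` is `inner ℝ c x`. -/
abbrev E (d : ℕ) : Type := EuclideanSpace ℝ (Fin d)

/-- A polytope: the convex hull of a nonempty finite set of points. -/
def IsPolytope {d : ℕ} (P : Set (E d)) : Prop :=
  ∃ S : Finset (E d), S.Nonempty ∧ P = convexHull ℝ (S : Set (E d))

/-- A zonotope: a translate of a Minkowski sum of finitely many segments `[-z_i, z_i]`. -/
def IsZonotope {d : ℕ} (P : Set (E d)) : Prop :=
  ∃ (n : ℕ) (t : E d) (z : Fin n → E d),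
    {-t} + P = ∑ i, segment ℝ (-(z i)) (z i)

/-- The vertex set `V(P)`. -/
def vertices {d : ℕ} (P : Set (E d)) : Set (E d) := P.extremePoints ℝ

/-- A polytope has finitely many vertices (so sums over `V(P)` below are finite sums). -/
theorem IsPolytope.finite_vertices {d : ℕ} {P : Set (E d)} (hP : IsPolytope P) :
    (vertices P).Finite := by
  obtain ⟨S, -, rfl⟩ := hP
  exact S.finite_toSet.subset extremePoints_convexHull_subset

/-- `uv` is an edge of `P`: `u ≠ v` are vertices and the segment `[u, v]` is a face of `P`. -/
def IsEdge {d : ℕ} (P : Set (E d)) (u v : E d) : Prop :=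
  u ∈ vertices P ∧ v ∈ vertices P ∧ u ≠ v ∧ IsExtreme ℝ P (segment ℝ u v)

/-- `c` is (edge) generic for `P`: it is not constant on any edge of `P`. -/
def IsGeneric {d : ℕ} (P : Set (E d)) (c : E d) : Prop :=
  ∀ u v : E d, IsEdge P u v → inner ℝ c u ≠ inner ℝ c v

/-- The `c`-improving neighbors of `v` in the graph of `P`. -/
def improvingNeighbors {d : ℕ} (P : Set (E d)) (c v : E d) : Set (E d) :=
  {u | IsEdge P u v ∧ inner ℝ c v < inner ℝ c u}

/-- `v` maximizes `c` over `P`. -/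
def IsOptimal {d : ℕ} (P : Set (E d)) (c v : E d) : Prop :=
  IsMaxOn (fun x : E d => inner ℝ c x) P v

/-- `v` minimizes `c` over `P`. -/
def IsPessimal {d : ℕ} (P : Set (E d)) (c v : E d) : Prop :=
  IsMinOn (fun x : E d => inner ℝ c x) P v

/-- A `c`-arborescence of `P`: a self-map of `V(P)` that fixes exactly the optimal vertex and
sends every other vertex to one of its `c`-improving neighbors. -/
structure IsArborescence {d : ℕ} (P : Set (E d)) (c : E d)
    (a : vertices P → vertices P) : Prop where
  fixed_iff : ∀ v : vertices P, a v = v ↔ IsOptimal P c v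
  improving : ∀ v : vertices P, ¬ IsOptimal P c v → (a v : E d) ∈ improvingNeighbors P c v

/-- The point `∑_v (a(v) - v) / N(a(v) - v)` of a self-map `a` of `V(P)`, for a normalization `N`.
A term with `a(v) = v` is zero. -/
noncomputable def arborescencePoint {d : ℕ} (P : Set (E d)) (N : E d → ℝ)
    (a : vertices P → vertices P) : E d :=
  ∑ᶠ v : vertices P, (N ((a v : E d) - v))⁻¹ • ((a v : E d) - v)

/-- The pivot rule polytope of `(P, c)` for the normalization `N`. -/
def pivotRulePolytope {d : ℕ} (P : Set (E d)) (c : E d) (N : E d → ℝ) : Set (E d) :=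
  convexHull ℝ {x | ∃ a : vertices P → vertices P,
    IsArborescence P c a ∧ x = arborescencePoint P N a}

/-- The max-slope pivot rule polytope: the normalization is `N(x) = c^t x`. -/
def maxSlopePivotRulePolytope {d : ℕ} (P : Set (E d)) (c : E d) : Set (E d) :=
  pivotRulePolytope P c (fun x => inner ℝ c x)

/-- `v 0, …, v k` is a monotone path of `(P, c)`: a `c`-increasing path in the graph of `P` from
the minimizing vertex to the maximizing vertex. (Values `v i` with `i > k` play no role.) -/
structure IsMonotonePath {d : ℕ} (P : Set (E d)) (c : E d) (k : ℕ) (v : ℕ → E d) : Prop where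
  start_mem : v 0 ∈ vertices P
  start_min : IsPessimal P c (v 0)
  step : ∀ i < k, v (i + 1) ∈ improvingNeighbors P c (v i)
  end_max : IsOptimal P c (v k)

/-- The point of a path `v 0, …, v k`: the average position along the path, parametrized by the
value of `c`. A step contributes its `c`-length times its midpoint. -/
noncomputable def pathPoint {d : ℕ} (c : E d) (k : ℕ) (v : ℕ → E d) : E d :=
  ∑ i ∈ Finset.range k,
    ((inner ℝ c (v (i + 1) - v i) : ℝ) / (inner ℝ c (v k - v 0) : ℝ)) •
      ((1 / 2 : ℝ) • (v (i + 1) + v i))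

/-- The Billera–Sturmfels monotone path polytope of `(P, c)`. -/
def monotonePathPolytope {d : ℕ} (P : Set (E d)) (c : E d) : Set (E d) :=
  convexHull ℝ {x | ∃ (k : ℕ) (v : ℕ → E d), IsMonotonePath P c k v ∧ x = pathPoint c k v}

/-- The polytope `Q` is a weak Minkowski summand of the polytope `P`: `r P = Q + R` for some
`r > 0` and some polytope `R`. -/
def IsWeakMinkowskiSummand {d : ℕ} (Q P : Set (E d)) : Prop :=
  IsPolytope Q ∧ IsPolytope P ∧
    ∃ (r : ℝ) (R : Set (E d)), 0 < r ∧ IsPolytope R ∧ r • P = Q + R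

/-- Two polytopes are normally equivalent if each is a weak Minkowski summand of the other. -/
def NormallyEquivalent {d : ℕ} (P Q : Set (E d)) : Prop :=
  IsWeakMinkowskiSummand Q P ∧ IsWeakMinkowskiSummand P Q

end PivotPolytopes

/-!
Both polytopes are compared through their linear functionals `w`. A functional `w` and the objective
`c` together project `P` to the plane, where an edge direction `x` has slope `⟪w, x⟫ / ⟪c, x⟫`.

* The point of an arborescence maximizes `w` over `Π` exactly when the arborescence picks an
  improving edge of maximal slope at every vertex (`IsMaxSlope`).
* For a monotone path, `w` applied to its point is, up to a common factor, the area below the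
  projected path (`inner_pathPoint`). Hence the maximizing paths are those that run along the upper
  boundary of the projection (`IsCoherent`). This is proved in both directions in
  `IsCoherent.inner_pathPoint_le` and `IsCoherent.of_inner_pathPoint_le`.
* A path that always takes the edge of maximal slope runs along the upper boundary
  (`IsGreedy.isCoherent`), because a vertex of a polytope that is optimal among its neighbors is
  optimal (`IsPolytope.le_of_forall_isEdge`).

So the path along a `w`-maximal arborescence is `w`-maximal. A combinatorial form of normal fan
refinement, proved with Farkas' lemma (`isWeakMinkowskiSummand_convexHull_range`), turns this
implication into the statement that `Mon` is a weak Minkowski summand of `Π`.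

For the converse on a zonotope, every edge is parallel to a step of any given monotone path
(`IsZonotope.exists_parallel_step`). Since slopes decrease along a coherent path, choosing at
every vertex the improving direction that occurs first on the path gives an arborescence which
depends on the path only, and which has maximal slopes for every `w` that the path maximizes. The
refinement criterion then applies with the roles of the two polytopes exchanged.
-/

open scoped Pointwise

namespace PivotPolytopes

variable {d : ℕ}

/-! ### A criterion for weak Minkowski summands -/

/-- **Farkas' lemma** for finitely many vectors, by induction on their number. -/
theorem farkas {ι : Type*} (s : Finset ι) (a : ι → E d) (b : E d)
    (h : ∀ w : E d, (∀ k ∈ s, inner ℝ (a k) w ≤ 0) → inner ℝ b w ≤ 0) :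
    ∃ l : ι → ℝ, (∀ k, 0 ≤ l k) ∧ b = ∑ k ∈ s, l k • a k := by
  classical
  induction s using Finset.induction_on generalizing a b with
  | empty =>
    refine ⟨fun _ => 0, fun _ => le_rfl, ?_⟩
    have := h b (by simp)
    simpa using real_inner_self_nonpos.mp this
  | insert j s hj ih =>
    by_cases hs : ∀ w : E d, (∀ k ∈ s, inner ℝ (a k) w ≤ 0) → inner ℝ b w ≤ 0
    · obtain ⟨l, hl, rfl⟩ := ih a b hs
      refine ⟨Function.update l j 0, fun k => ?_, ?_⟩
      · by_cases hk : k = j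
        · simp [hk]
        · simpa [hk] using hl k
      · rw [Finset.sum_insert hj]
        simp only [Function.update_self, zero_smul, zero_add]
        refine Finset.sum_congr rfl fun k hk => ?_
        rw [Function.update_of_ne (ne_of_mem_of_not_mem hk hj)]
    · -- Here `b` is positive at some `x` in the polar of the family `s`, hence so is `a j`.
      push Not at hs
      obtain ⟨x, hx, hbx⟩ := hs
      have hjx : 0 < inner ℝ (a j) x := by
        by_contra hcon
        refine absurd (h x fun k hk => ?_) hbx.not_ge
        rcases Finset.mem_insert.mp hk with rfl | hk
        · exact not_lt.mp hcon
        · exact hx k hk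
      -- Projecting along `x` onto the orthogonal complement of `a j` reduces to the family `s`.
      obtain ⟨l, hl, hb⟩ := ih (fun k => a k - (inner ℝ (a k) x / inner ℝ (a j) x) • a j)
        (b - (inner ℝ b x / inner ℝ (a j) x) • a j) (fun w hw => by
          have key : ∀ y : E d, inner ℝ (y - (inner ℝ y x / inner ℝ (a j) x) • a j) w =
              inner ℝ y (w - (inner ℝ (a j) w / inner ℝ (a j) x) • x) := fun y => by
            simp only [inner_sub_left, inner_sub_right, real_inner_smul_left,
              real_inner_smul_right]
            ring
          rw [key]
          refine h _ fun k hk => ?_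
          rcases Finset.mem_insert.mp hk with rfl | hk
          · rw [inner_sub_right, real_inner_smul_right, div_mul_cancel₀ _ hjx.ne', sub_self]
          · rw [← key]
            exact hw k hk)
      set t : ℝ := (inner ℝ b x - ∑ k ∈ s, l k * inner ℝ (a k) x) / inner ℝ (a j) x with ht
      refine ⟨Function.update l j t, fun k => ?_, ?_⟩
      · by_cases hk : k = j
        · subst hk
          simp only [Function.update_self]
          refine div_nonneg (sub_nonneg.mpr (le_trans ?_ hbx.le)) hjx.le
          exact Finset.sum_nonpos fun i hi => mul_nonpos_of_nonneg_of_nonpos (hl i) (hx i hi)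
        · simpa [hk] using hl k
      · rw [Finset.sum_insert hj, Function.update_self]
        have : ∑ k ∈ s, Function.update l j t k • a k = ∑ k ∈ s, l k • a k :=
          Finset.sum_congr rfl fun k hk => by
            rw [Function.update_of_ne (ne_of_mem_of_not_mem hk hj)]
        rw [this, eq_add_of_sub_eq hb, ht]
        simp only [smul_sub, Finset.sum_sub_distrib, smul_smul, ← Finset.sum_smul, sub_div,
          sub_smul, Finset.sum_div, mul_div_assoc]
        abel

theorem isPolytope_convexHull_range {ι : Type*} [Finite ι] [Nonempty ι] (p : ι → E d) :
    IsPolytope (convexHull ℝ (Set.range p)) := by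
  refine ⟨(Set.finite_range p).toFinset, ?_, by simp⟩
  simpa using Set.range_nonempty p

/-- If `p i` maximizes a functional only when `q i` does, that is, if the normal fan of the hull of
`p` refines that of `q`, then the hull of `q` is a weak Minkowski summand of the hull of `p`. The
complement is spanned by the points `r • p i - q i` for large `r`: Farkas' lemma writes each
`q j - q i` as a nonnegative combination of the vectors `p k - p i`, and `r` has to exceed the sums
of the coefficients. -/
theorem isWeakMinkowskiSummand_convexHull_range {ι : Type*} [Finite ι] [Nonempty ι]
    (p q : ι → E d)
    (h : ∀ (i : ι) (w : E d), (∀ k, inner ℝ w (p k) ≤ inner ℝ w (p i)) →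
      ∀ j, inner ℝ w (q j) ≤ inner ℝ w (q i)) :
    IsWeakMinkowskiSummand (convexHull ℝ (Set.range q)) (convexHull ℝ (Set.range p)) := by
  have := Fintype.ofFinite ι
  refine ⟨isPolytope_convexHull_range q, isPolytope_convexHull_range p, ?_⟩
  have hf : ∀ i j, ∃ l : ι → ℝ, (∀ k, 0 ≤ l k) ∧ q j - q i = ∑ k, l k • (p k - p i) := by
    intro i j
    refine farkas Finset.univ (fun k => p k - p i) (q j - q i) fun w hw => ?_
    have := h i w (fun k => by
      have := hw k (Finset.mem_univ k)
      rw [inner_sub_left] at this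
      simpa only [real_inner_comm w] using sub_nonpos.mp this) j
    rw [inner_sub_left, sub_nonpos]
    simpa only [real_inner_comm w] using this
  choose l hl hq using hf
  set r : ℝ := 1 + ∑ i, ∑ j, ∑ k, l i j k with hr
  have hle : ∀ i j, ∑ k, l i j k ≤ r := fun i j => by
    have h1 : ∑ k, l i j k ≤ ∑ j, ∑ k, l i j k :=
      Finset.single_le_sum (f := fun j => ∑ k, l i j k)
        (fun j _ => Finset.sum_nonneg fun k _ => hl i j k) (Finset.mem_univ j)
    have h2 : ∑ j, ∑ k, l i j k ≤ ∑ i, ∑ j, ∑ k, l i j k :=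
      Finset.single_le_sum (f := fun i => ∑ j, ∑ k, l i j k)
        (fun i _ => Finset.sum_nonneg fun j _ => Finset.sum_nonneg fun k _ => hl i j k)
        (Finset.mem_univ i)
    linarith
  have hr0 : 0 < r := by
    have : 0 ≤ ∑ i, ∑ j, ∑ k, l i j k := Finset.sum_nonneg fun i _ =>
      Finset.sum_nonneg fun j _ => Finset.sum_nonneg fun k _ => hl i j k
    linarith
  refine ⟨r, convexHull ℝ (Set.range fun i => r • p i - q i), hr0,
    isPolytope_convexHull_range _, Set.Subset.antisymm ?_ ?_⟩
  · rw [← convexHull_smul, ← convexHull_add]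
    refine convexHull_mono ?_
    rintro _ ⟨_, ⟨i, rfl⟩, rfl⟩
    exact ⟨q i, ⟨i, rfl⟩, r • p i - q i, ⟨i, rfl⟩, by simp⟩
  · rw [← convexHull_add]
    refine convexHull_min ?_ ((convex_convexHull ℝ _).smul r)
    rintro _ ⟨_, ⟨j, rfl⟩, _, ⟨i, rfl⟩, rfl⟩
    -- `q j + (r • p i - q i)` is `r` times a convex combination of the points `p k` and `p i`.
    have hmem : ∀ k, p k ∈ convexHull ℝ (Set.range p) :=
      fun k => subset_convexHull ℝ _ ⟨k, rfl⟩
    refine ⟨∑ o : Option ι, (r⁻¹ * o.elim (r - ∑ k, l i j k) (l i j)) • o.elim (p i) p,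
      (convex_convexHull ℝ _).sum_mem ?_ ?_ ?_, ?_⟩
    · rintro (_ | k) -
      · exact mul_nonneg (inv_nonneg.mpr hr0.le) (sub_nonneg.mpr (hle i j))
      · exact mul_nonneg (inv_nonneg.mpr hr0.le) (hl i j k)
    · rw [← Finset.mul_sum, Fintype.sum_option]
      simp [hr0.ne']
    · rintro (_ | k) -
      · exact hmem i
      · exact hmem k
    · simp only [mul_smul, ← Finset.smul_sum, smul_inv_smul₀ hr0.ne', Fintype.sum_option,
        Option.elim_none, Option.elim_some]
      have := hq i j
      simp only [smul_sub, Finset.sum_sub_distrib, ← Finset.sum_smul] at this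
      rw [sub_smul, add_sub_left_comm, this]
      abel

theorem convexHull_range_subset {ι κ : Type*} [Finite ι] (p : ι → E d) (q : κ → E d)
    (h : ∀ (w : E d) (j : κ), ∃ i, inner ℝ w (q j) ≤ inner ℝ w (p i)) :
    convexHull ℝ (Set.range q) ⊆ convexHull ℝ (Set.range p) := by
  refine convexHull_min ?_ (convex_convexHull ℝ _)
  rintro _ ⟨j, rfl⟩
  by_contra hj
  obtain ⟨f, u, hf, hu⟩ := geometric_hahn_banach_closed_point (convex_convexHull ℝ _)
    ((Set.finite_range p).isClosed_convexHull ℝ) hj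
  obtain ⟨i, hi⟩ := h ((InnerProductSpace.toDual ℝ (E d)).symm f) j
  simp only [InnerProductSpace.toDual_symm_apply] at hi
  have := hf (p i) (subset_convexHull ℝ _ ⟨i, rfl⟩)
  linarith

/-! ### Vertices and edges of polytopes -/

theorem IsPolytope.isCompact {P : Set (E d)} (hP : IsPolytope P) : IsCompact P := by
  obtain ⟨S, -, rfl⟩ := hP
  exact S.finite_toSet.isCompact_convexHull ℝ

theorem IsPolytope.convex {P : Set (E d)} (hP : IsPolytope P) : Convex ℝ P := by
  obtain ⟨S, -, rfl⟩ := hP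
  exact convex_convexHull ℝ _

theorem IsPolytope.nonempty {P : Set (E d)} (hP : IsPolytope P) : P.Nonempty := by
  obtain ⟨S, hS, rfl⟩ := hP
  exact Set.Nonempty.convexHull (by simpa using hS)

theorem IsPolytope.convexHull_vertices {P : Set (E d)} (hP : IsPolytope P) :
    convexHull ℝ (vertices P) = P := by
  rw [← (hP.finite_vertices.isClosed_convexHull ℝ).closure_eq]
  exact closure_convexHull_extremePoints hP.isCompact hP.convex

theorem vertices_subset (P : Set (E d)) : vertices P ⊆ P := extremePoints_subset

/-- The cone of a convex set at an extreme point is pointed. -/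
theorem eq_zero_of_sum_smul_sub_eq_zero {P : Set (E d)} (hP : Convex ℝ P) {v : E d}
    (hv : v ∈ vertices P) {N : Finset (E d)} (hN : ∀ u ∈ N, u ∈ P \ {v}) {β : E d → ℝ}
    (hβ : ∀ u ∈ N, 0 ≤ β u) (h : ∑ u ∈ N, β u • (u - v) = 0) : ∀ u ∈ N, β u = 0 := by
  by_contra hcon
  push Not at hcon
  obtain ⟨g, hg, hg0⟩ := hcon
  have hpos : 0 < ∑ u ∈ N, β u :=
    Finset.sum_pos' hβ ⟨g, hg, lt_of_le_of_ne (hβ g hg) hg0.symm⟩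
  have hv' := hP.mem_extremePoints_iff_mem_sdiff_convexHull_sdiff.mp hv
  refine hv'.2 ?_
  have : v = ∑ u ∈ N, ((∑ u ∈ N, β u)⁻¹ * β u) • u := by
    simp only [smul_sub, Finset.sum_sub_distrib, ← Finset.sum_smul, sub_eq_zero] at h
    simp only [mul_smul, ← Finset.smul_sum, h]
    rw [inv_smul_smul₀ hpos.ne']
  refine Set.mem_of_eq_of_mem this ((convex_convexHull ℝ _).sum_mem
    (fun u hu => mul_nonneg (inv_nonneg.mpr hpos.le) (hβ u hu)) ?_
    (fun u hu => subset_convexHull ℝ _ (hN u hu)))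
  rw [← Finset.mul_sum, inv_mul_cancel₀ hpos.ne']

/-- A polytope lies in the cone at a vertex `v` that is spanned by the edges at `v`: in a minimal
generating set of a pointed cone every generator spans an extreme ray. -/
theorem IsPolytope.exists_sub_eq_sum_neighbors {P : Set (E d)} (hP : IsPolytope P) {v : E d}
    (hv : v ∈ vertices P) :
    ∃ N : Finset (E d), (∀ u ∈ N, IsEdge P u v) ∧ ∀ x ∈ P, ∃ β : E d → ℝ, (∀ u, 0 ≤ β u) ∧
      x - v = ∑ u ∈ N, β u • (u - v) := by
  classical
  -- The edges come from an inclusion-minimal set of vertices whose differences with `v` span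
  -- the cone of `P` at `v`.
  obtain ⟨N, ⟨hNV, hN⟩, hmin⟩ := (wellFounded_lt (α := Finset (E d))).has_min
    {N | (∀ u ∈ N, u ∈ vertices P \ {v}) ∧ ∀ x ∈ P, ∃ β : E d → ℝ, (∀ u, 0 ≤ β u) ∧
      x - v = ∑ u ∈ N, β u • (u - v)} (by
    refine ⟨hP.finite_vertices.toFinset.erase v, fun u hu => by
      simpa [and_comm] using hu, fun x hx => ?_⟩
    rw [← hP.convexHull_vertices, ← hP.finite_vertices.coe_toFinset,
      Finset.mem_convexHull'] at hx
    obtain ⟨β, hβ0, hβ1, rfl⟩ := hx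
    refine ⟨fun u => |β u|, fun u => abs_nonneg _, ?_⟩
    rw [Finset.sum_erase _ (by simp)]
    have habs : ∀ u ∈ hP.finite_vertices.toFinset, |β u| • (u - v) = β u • u - β u • v :=
      fun u hu => by rw [abs_of_nonneg (hβ0 u hu), smul_sub]
    rw [Finset.sum_congr rfl habs, Finset.sum_sub_distrib, ← Finset.sum_smul, hβ1, one_smul])
  refine ⟨N, fun g hg => ⟨(hNV g hg).1, hv, (hNV g hg).2, ?_⟩, hN⟩
  have hgV := (hNV g hg).1
  have hgv : g ≠ v := (hNV g hg).2
  refine ⟨hP.convex.segment_subset (vertices_subset P hgV) (vertices_subset P hv), ?_⟩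
  intro x hx y hy z hz hzxy
  obtain ⟨s, ⟨hs0, hs1⟩, hs⟩ : ∃ s : ℝ, (0 ≤ s ∧ s ≤ 1) ∧ z - v = s • (g - v) := by
    obtain ⟨a, b, ha, hb, hab, rfl⟩ := hz
    refine ⟨a, ⟨ha, by linarith⟩, ?_⟩
    obtain rfl : b = 1 - a := by linarith
    module
  obtain ⟨a, b, ha, hb, hab, hz'⟩ := hzxy
  obtain ⟨β, hβ0, hβ⟩ := hN x hx
  obtain ⟨β', hβ'0, hβ'⟩ := hN y hy
  set γ : E d → ℝ := fun u => a * β u + b * β' u with hγ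
  have hγ0 : ∀ u, 0 ≤ γ u := fun u =>
    add_nonneg (mul_nonneg ha.le (hβ0 u)) (mul_nonneg hb.le (hβ'0 u))
  have hsum : ∑ u ∈ N, γ u • (u - v) = s • (g - v) := by
    simp only [hγ, add_smul, mul_smul, Finset.sum_add_distrib, ← Finset.smul_sum, ← hβ, ← hβ',
      ← hs, ← hz']
    obtain rfl : b = 1 - a := by linarith
    module
  have hsplit : γ g • (g - v) + ∑ u ∈ N.erase g, γ u • (u - v) = s • (g - v) := by
    rw [Finset.add_sum_erase N (fun u => γ u • (u - v)) hg, hsum]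
  rcases lt_or_ge (γ g) s with hlt | hge
  · -- Otherwise `g` would be redundant.
    exfalso
    refine hmin (N.erase g) ⟨fun u hu => hNV u (Finset.mem_of_mem_erase hu), fun t ht => ?_⟩
      (Finset.erase_ssubset hg)
    obtain ⟨δ, hδ0, hδ⟩ := hN t ht
    have hd : 0 < s - γ g := sub_pos.mpr hlt
    refine ⟨fun u => δ u + δ g * ((s - γ g)⁻¹ * γ u), fun u => add_nonneg (hδ0 u)
      (mul_nonneg (hδ0 g) (mul_nonneg (inv_nonneg.mpr hd.le) (hγ0 u))), ?_⟩
    have hg' : g - v = (s - γ g)⁻¹ • ∑ u ∈ N.erase g, γ u • (u - v) := by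
      rw [eq_inv_smul_iff₀ hd.ne', sub_smul, ← hsplit, add_sub_cancel_left]
    rw [hδ, ← Finset.add_sum_erase N (fun u => δ u • (u - v)) hg]
    simp only [add_smul, mul_smul, Finset.sum_add_distrib, ← Finset.smul_sum, ← hg']
    rw [add_comm]
  · have hzero := eq_zero_of_sum_smul_sub_eq_zero hP.convex hv (N := N)
      (fun u hu => ⟨vertices_subset P (hNV u hu).1, (hNV u hu).2⟩)
      (β := fun u => if u = g then γ g - s else γ u) (fun u _ => by
        split_ifs
        · exact sub_nonneg.mpr hge
        · exact hγ0 u) (by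
        rw [← Finset.add_sum_erase N _ hg, if_pos rfl]
        rw [Finset.sum_congr rfl (g := fun u => γ u • (u - v)) fun u hu => by
          rw [if_neg (Finset.ne_of_mem_erase hu)], sub_smul, ← hsplit]
        abel)
    have hβu : ∀ u ∈ N.erase g, β u • (u - v) = 0 := fun u hu => by
      have h1 := hzero u (Finset.mem_of_mem_erase hu)
      rw [if_neg (Finset.ne_of_mem_erase hu)] at h1
      have h2 : a * β u = 0 := by
        have := mul_nonneg ha.le (hβ0 u)
        have := mul_nonneg hb.le (hβ'0 u)
        simp only [hγ] at h1
        linarith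
      rw [(mul_eq_zero.mp h2).resolve_left ha.ne', zero_smul]
    have hxg : x - v = β g • (g - v) := by
      rw [hβ, ← Finset.add_sum_erase N _ hg, Finset.sum_eq_zero hβu, add_zero]
    have hx' : x = β g • g + (1 - β g) • v := by
      rw [sub_eq_iff_eq_add.mp hxg]
      module
    rcases le_or_gt (β g) 1 with hle | hgt
    · exact ⟨β g, 1 - β g, hβ0 g, sub_nonneg.mpr hle, by ring, hx'.symm⟩
    · exfalso
      refine hgv (hgV.2 (vertices_subset P hv) hx ?_).symm
      have h0 : 0 < β g := by linarith
      refine ⟨1 - (β g)⁻¹, (β g)⁻¹, sub_pos.mpr (inv_lt_one_of_one_lt₀ hgt), inv_pos.mpr h0,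
        by ring, ?_⟩
      rw [hx', smul_add, inv_smul_smul₀ h0.ne', smul_smul, mul_sub, inv_mul_cancel₀ h0.ne']
      module

/-- The local optimality criterion of the simplex method. -/
theorem IsPolytope.le_of_forall_isEdge {P : Set (E d)} (hP : IsPolytope P) {v : E d}
    (hv : v ∈ vertices P) {y : E d}
    (h : ∀ u, IsEdge P u v → inner ℝ y u ≤ inner ℝ y v) {x : E d} (hx : x ∈ P) :
    inner ℝ y x ≤ inner ℝ y v := by
  obtain ⟨N, hN, hcone⟩ := hP.exists_sub_eq_sum_neighbors hv
  obtain ⟨β, hβ0, hβ⟩ := hcone x hx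
  rw [← sub_nonpos, ← inner_sub_right, hβ, inner_sum]
  refine Finset.sum_nonpos fun u hu => ?_
  rw [real_inner_smul_right, inner_sub_right]
  exact mul_nonpos_of_nonneg_of_nonpos (hβ0 u) (sub_nonpos.mpr (h u (hN u hu)))

theorem IsPolytope.exists_improvingNeighbor {P : Set (E d)} (hP : IsPolytope P) {c v : E d}
    (hv : v ∈ vertices P) (hopt : ¬ IsOptimal P c v) : (improvingNeighbors P c v).Nonempty := by
  by_contra hne
  refine hopt fun x hx => hP.le_of_forall_isEdge hv (fun u hu => ?_) hx
  by_contra hlt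
  exact hne ⟨u, hu, not_le.mp hlt⟩

theorem IsPolytope.exists_isPessimal {P : Set (E d)} (hP : IsPolytope P) (c : E d) :
    ∃ v ∈ vertices P, IsPessimal P c v := by
  obtain ⟨v, hv, hmin⟩ := hP.finite_vertices.exists_minimalFor (fun x : E d => (inner ℝ c x : ℝ)) _
    (hP.isCompact.extremePoints_nonempty hP.nonempty)
  refine ⟨v, hv, fun x hx => ?_⟩
  rw [← hP.convexHull_vertices] at hx
  have hconv : Convex ℝ {x : E d | (inner ℝ c v : ℝ) ≤ inner ℝ c x} :=
    convex_halfSpace_ge (innerSL ℝ c).isLinear _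
  refine convexHull_min (fun u hu => ?_) hconv hx
  rcases le_total (inner ℝ c v : ℝ) (inner ℝ c u) with h | h
  · exact h
  · exact hmin hu h

/-- A generic objective function has only one minimizer: it is strictly positive on the edge
directions at a minimizing vertex `v`, and these span the cone that contains `x - v`. -/
theorem IsPolytope.eq_of_isPessimal {P : Set (E d)} (hP : IsPolytope P) {c v x : E d}
    (hc : IsGeneric P c) (hv : v ∈ vertices P) (hmin : IsPessimal P c v) (hx : x ∈ P)
    (hxmin : IsPessimal P c x) : x = v := by
  obtain ⟨N, hN, hcone⟩ := hP.exists_sub_eq_sum_neighbors hv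
  obtain ⟨β, hβ0, hβ⟩ := hcone x hx
  have hcx : ∑ u ∈ N, β u * (inner ℝ c u - inner ℝ c v) = 0 := by
    have : (inner ℝ c (x - v) : ℝ) = 0 := by
      rw [inner_sub_right, sub_eq_zero]
      exact le_antisymm (hxmin (vertices_subset P hv)) (hmin hx)
    rw [hβ, inner_sum] at this
    simpa only [real_inner_smul_right, inner_sub_right] using this
  have hlt : ∀ u ∈ N, (inner ℝ c v : ℝ) < inner ℝ c u := fun u hu =>
    lt_of_le_of_ne (hmin (vertices_subset P (hN u hu).1)) (hc u v (hN u hu)).symm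
  have hzero := (Finset.sum_eq_zero_iff_of_nonneg fun u hu =>
    mul_nonneg (hβ0 u) (sub_pos.mpr (hlt u hu)).le).mp hcx
  rw [← sub_eq_zero, hβ]
  refine Finset.sum_eq_zero fun u hu => ?_
  rw [(mul_eq_zero.mp (hzero u hu)).resolve_right (sub_pos.mpr (hlt u hu)).ne', zero_smul]

/-! ### Coherent monotone paths -/

/-- The slope of the direction `x` in the plane projection `(c, w)`. It is `0` for `x = 0`, which
occurs as `a v - v` at the optimal vertex `v` of an arborescence `a`. -/
noncomputable def slope (c w x : E d) : ℝ := inner ℝ w x / inner ℝ c x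

theorem slope_mul {c w x : E d} (h : 0 < (inner ℝ c x : ℝ)) :
    slope c w x * inner ℝ c x = inner ℝ w x :=
  div_mul_cancel₀ _ h.ne'

/-- A path `v 0, …, v k` is coherent for `w` if each of its steps projects onto the upper boundary
of the image of `P` under `(c, w)`: the line through the projected step lies above the image. -/
def IsCoherent (P : Set (E d)) (c w : E d) (k : ℕ) (v : ℕ → E d) : Prop :=
  ∀ i < k, ∀ x ∈ P, inner ℝ w (x - v i) ≤ slope c w (v (i + 1) - v i) * inner ℝ c (x - v i)

/-- A path is greedy for `w` if each of its steps has the largest slope among all improving edges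
at its starting point. -/
def IsGreedy (P : Set (E d)) (c w : E d) (k : ℕ) (v : ℕ → E d) : Prop :=
  ∀ i < k, ∀ u ∈ improvingNeighbors P c (v i), slope c w (u - v i) ≤ slope c w (v (i + 1) - v i)

section Path

variable {P : Set (E d)} {c w : E d} {k : ℕ} {v : ℕ → E d}

theorem IsMonotonePath.mem_vertices (hv : IsMonotonePath P c k v) {i : ℕ} (hi : i ≤ k) :
    v i ∈ vertices P := by
  cases i with
  | zero => exact hv.start_mem
  | succ i => exact (hv.step i hi).1.1

theorem IsMonotonePath.mem (hv : IsMonotonePath P c k v) {i : ℕ} (hi : i ≤ k) : v i ∈ P :=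
  vertices_subset P (hv.mem_vertices hi)

theorem IsMonotonePath.step_pos (hv : IsMonotonePath P c k v) {i : ℕ} (hi : i < k) :
    0 < (inner ℝ c (v (i + 1) - v i) : ℝ) := by
  rw [inner_sub_right]
  exact sub_pos.mpr (hv.step i hi).2

theorem IsMonotonePath.inner_lt (hv : IsMonotonePath P c k v) {i j : ℕ} (hij : i < j)
    (hj : j ≤ k) : (inner ℝ c (v i) : ℝ) < inner ℝ c (v j) := by
  induction j, hij using Nat.le_induction with
  | base => exact (hv.step i hj).2
  | succ j hij ih => exact (ih (Nat.le_of_succ_le hj)).trans (hv.step j hj).2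

theorem IsMonotonePath.eq_zero_iff (hv : IsMonotonePath P c k v) :
    k = 0 ↔ (inner ℝ c (v 0) : ℝ) = inner ℝ c (v k) := by
  refine ⟨fun h => by rw [h], fun h => ?_⟩
  by_contra hk
  exact (hv.inner_lt (Nat.pos_of_ne_zero hk) le_rfl).ne h

theorem IsMonotonePath.inner_start_eq (hv : IsMonotonePath P c k v) {k' : ℕ} {v' : ℕ → E d}
    (hv' : IsMonotonePath P c k' v') : (inner ℝ c (v 0) : ℝ) = inner ℝ c (v' 0) :=
  le_antisymm (hv.start_min (hv'.mem (Nat.zero_le _))) (hv'.start_min (hv.mem (Nat.zero_le _)))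

theorem IsMonotonePath.inner_end_eq (hv : IsMonotonePath P c k v) {k' : ℕ} {v' : ℕ → E d}
    (hv' : IsMonotonePath P c k' v') : (inner ℝ c (v k) : ℝ) = inner ℝ c (v' k') :=
  le_antisymm (hv'.end_max (hv.mem le_rfl)) (hv.end_max (hv'.mem le_rfl))

/-- A greedy path runs along the upper boundary of the projection `(c, w)`. By the local
optimality criterion it suffices to bound the slopes at the edges of each vertex of the path; at
an edge where `c` decreases, the bound follows from the one for the previous step. -/
theorem IsGreedy.isCoherent (hP : IsPolytope P) (hc : IsGeneric P c)
    (hv : IsMonotonePath P c k v) (hg : IsGreedy P c w k v) : IsCoherent P c w k v := by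
  intro i
  induction i with
  | zero =>
    intro hi x hx
    have := hP.le_of_forall_isEdge (hv.mem_vertices hi.le)
      (y := w - slope c w (v (0 + 1) - v 0) • c) (fun u hu => ?_) hx
    · simp only [inner_sub_left, real_inner_smul_left] at this
      rw [inner_sub_right, inner_sub_right]
      linarith
    · have hlt : (inner ℝ c (v 0) : ℝ) < inner ℝ c u :=
        lt_of_le_of_ne (hv.start_min (vertices_subset P hu.1)) (hc u _ hu).symm
      have h1 := hg 0 hi u ⟨hu, hlt⟩
      have hpos : 0 < (inner ℝ c (u - v 0) : ℝ) := by
        rw [inner_sub_right]; exact sub_pos.mpr hlt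
      have h2 := mul_le_mul_of_nonneg_right h1 hpos.le
      rw [slope_mul hpos] at h2
      rw [inner_sub_right, inner_sub_right] at h2
      simp only [inner_sub_left, real_inner_smul_left]
      linarith
  | succ i ih =>
    intro hi x hx
    have hsupp := ih (Nat.lt_of_succ_lt hi)
    have hstep := slope_mul (w := w) (hv.step_pos (Nat.lt_of_succ_lt hi))
    have hstep' := slope_mul (w := w) (hv.step_pos hi)
    have hpos' := hv.step_pos hi
    set m := slope c w (v (i + 1) - v i)
    set m' := slope c w (v (i + 1 + 1) - v (i + 1))
    have hmm : m' ≤ m := by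
      have h1 := hsupp _ (hv.mem hi)
      simp only [inner_sub_right] at h1 hstep hstep' hpos'
      by_contra! hcon
      nlinarith [mul_pos (sub_pos.mpr hcon) hpos']
    have := hP.le_of_forall_isEdge (hv.mem_vertices hi.le) (y := w - m' • c) (fun u hu => ?_) hx
    · simp only [inner_sub_left, real_inner_smul_left] at this
      rw [inner_sub_right, inner_sub_right]
      linarith
    · simp only [inner_sub_left, real_inner_smul_left]
      rcases lt_or_gt_of_ne (hc u _ hu) with hlt | hgt
      · have h1 := hsupp u (vertices_subset P hu.1)
        simp only [inner_sub_right] at h1 hstep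
        nlinarith [mul_nonneg (sub_nonneg.mpr hmm) (sub_pos.mpr hlt).le]
      · have h1 := hg _ hi u ⟨hu, hgt⟩
        have hpos : 0 < (inner ℝ c (u - v (i + 1)) : ℝ) := by
          rw [inner_sub_right]; exact sub_pos.mpr hgt
        have h2 := mul_le_mul_of_nonneg_right h1 hpos.le
        rw [slope_mul hpos] at h2
        rw [inner_sub_right, inner_sub_right] at h2
        linarith

/-- The slopes decrease along a coherent path. -/
theorem IsCoherent.slope_le (hv : IsMonotonePath P c k v) (hw : IsCoherent P c w k v) {i j : ℕ}
    (hij : i ≤ j) (hj : j < k) :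
    slope c w (v (j + 1) - v j) ≤ slope c w (v (i + 1) - v i) := by
  have h1 := hw i (hij.trans_lt hj) _ (hv.mem (Nat.succ_le_of_lt hj))
  have h2 := hw j hj _ (hv.mem (hij.trans hj.le))
  have h3 := slope_mul (w := w) (hv.step_pos hj)
  have hlt := hv.inner_lt (Nat.lt_succ_of_le hij) hj
  simp only [inner_sub_right] at h1 h2 h3
  by_contra! hcon
  nlinarith [mul_pos (sub_pos.mpr hcon) (sub_pos.mpr hlt)]

/-- The affine function whose graph is the line through the image of the step `v i, v (i + 1)`
under `(c, w)`. -/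
noncomputable def stepLine (c w : E d) (v : ℕ → E d) (i : ℕ) (t : ℝ) : ℝ :=
  inner ℝ w (v i) + slope c w (v (i + 1) - v i) * (t - inner ℝ c (v i))

theorem continuous_stepLine (c w : E d) (v : ℕ → E d) (i : ℕ) :
    Continuous (stepLine c w v i) := by
  unfold stepLine
  fun_prop

theorem integral_stepLine (hv : IsMonotonePath P c k v) {i : ℕ} (hi : i < k) :
    ∫ t in (inner ℝ c (v i))..(inner ℝ c (v (i + 1))), stepLine c w v i t =
      inner ℝ c (v (i + 1) - v i) * inner ℝ w ((1 / 2 : ℝ) • (v (i + 1) + v i)) := by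
  have h := slope_mul (w := w) (hv.step_pos hi)
  unfold stepLine
  rw [intervalIntegral.integral_add (by simp) (Continuous.intervalIntegrable (by fun_prop) _ _),
    intervalIntegral.integral_const_mul, intervalIntegral.integral_sub (by simp) (by simp)]
  simp only [intervalIntegral.integral_const, integral_id, smul_eq_mul, real_inner_smul_right,
    inner_add_right]
  simp only [inner_sub_right] at h ⊢
  set m := slope c w (v (i + 1) - v i)
  linear_combination (1 / 2 * (inner ℝ c (v (i + 1)) - inner ℝ c (v i))) * h

theorem stepLine_le (hP : Convex ℝ P) (hv : IsMonotonePath P c k v) {F : ℝ → ℝ}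
    (hF : ∀ x ∈ P, (inner ℝ w x : ℝ) ≤ F (inner ℝ c x)) {i : ℕ} (hi : i < k) {t : ℝ}
    (ht : t ∈ Set.Icc (inner ℝ c (v i) : ℝ) (inner ℝ c (v (i + 1)))) :
    stepLine c w v i t ≤ F t := by
  have hpos := hv.step_pos hi
  set s : ℝ := (t - inner ℝ c (v i)) / inner ℝ c (v (i + 1) - v i) with hs
  have hts : s * inner ℝ c (v (i + 1) - v i) = t - inner ℝ c (v i) := div_mul_cancel₀ _ hpos.ne'
  have hs0 : 0 ≤ s := div_nonneg (sub_nonneg.mpr ht.1) hpos.le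
  have hs1 : s ≤ 1 := by
    rw [hs, div_le_one hpos, inner_sub_right]
    exact sub_le_sub_right ht.2 _
  have hx : v i + s • (v (i + 1) - v i) ∈ P :=
    hP.add_smul_sub_mem (hv.mem hi.le) (hv.mem hi) ⟨hs0, hs1⟩
  have h := hF _ hx
  simp only [inner_add_right, real_inner_smul_right, hts, add_sub_cancel] at h
  rwa [← slope_mul (w := w) hpos, mul_left_comm, hts] at h

/-- Up to the total `c`-length, the value of `w` at the point of a path is the area below the image
of the path under `(c, w)`. For a path without steps both sides are `0`. -/
theorem inner_pathPoint (c w : E d) (k : ℕ) (v : ℕ → E d) :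
    (inner ℝ w (pathPoint c k v) : ℝ) = (∑ i ∈ Finset.range k,
      inner ℝ c (v (i + 1) - v i) * inner ℝ w ((1 / 2 : ℝ) • (v (i + 1) + v i))) /
        inner ℝ c (v k - v 0) := by
  rw [pathPoint, inner_sum, Finset.sum_div]
  refine Finset.sum_congr rfl fun i _ => ?_
  rw [real_inner_smul_right, div_mul_eq_mul_div]

theorem sum_integral_steps (c : E d) (k : ℕ) (v : ℕ → E d) {F : ℝ → ℝ} (hF : Continuous F) :
    ∑ i ∈ Finset.range k, ∫ t in (inner ℝ c (v i))..(inner ℝ c (v (i + 1))), F t =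
      ∫ t in (inner ℝ c (v 0))..(inner ℝ c (v k)), F t :=
  intervalIntegral.sum_integral_adjacent_intervals (a := fun i => inner ℝ c (v i))
    fun _ _ => hF.intervalIntegrable _ _

theorem area_step_le (hP : Convex ℝ P) (hv : IsMonotonePath P c k v) {F : ℝ → ℝ}
    (hFc : Continuous F) (hF : ∀ x ∈ P, (inner ℝ w x : ℝ) ≤ F (inner ℝ c x)) {i : ℕ}
    (hi : i < k) :
    inner ℝ c (v (i + 1) - v i) * inner ℝ w ((1 / 2 : ℝ) • (v (i + 1) + v i)) ≤
      ∫ t in (inner ℝ c (v i))..(inner ℝ c (v (i + 1))), F t := by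
  rw [← integral_stepLine hv hi]
  exact intervalIntegral.integral_mono_on (hv.step i hi).2.le
    ((continuous_stepLine c w v i).intervalIntegrable _ _) (hFc.intervalIntegrable _ _)
    fun t ht => stepLine_le hP hv hF hi ht

/-- The upper boundary of the image of `P` under `(c, w)`, as read off from a coherent path. -/
theorem IsCoherent.exists_upper_boundary (hP : Convex ℝ P) (hv : IsMonotonePath P c k v)
    (hw : IsCoherent P c w k v) (hk : k ≠ 0) :
    ∃ F : ℝ → ℝ, Continuous F ∧ (∀ x ∈ P, (inner ℝ w x : ℝ) ≤ F (inner ℝ c x)) ∧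
      (∀ t, ∃ i < k, F t = stepLine c w v i t) ∧
      ∑ i ∈ Finset.range k,
        inner ℝ c (v (i + 1) - v i) * inner ℝ w ((1 / 2 : ℝ) • (v (i + 1) + v i)) =
          ∫ t in (inner ℝ c (v 0))..(inner ℝ c (v k)), F t := by
  have hne : (Finset.range k).Nonempty := Finset.nonempty_range_iff.mpr hk
  have hFc : Continuous fun t => (Finset.range k).inf' hne fun i => stepLine c w v i t :=
    Continuous.finset_inf'_apply hne fun i _ => continuous_stepLine c w v i
  have hF : ∀ x ∈ P, (inner ℝ w x : ℝ) ≤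
      (Finset.range k).inf' hne fun i => stepLine c w v i (inner ℝ c x) := fun x hx =>
    Finset.le_inf' _ _ fun i hi => by
      have := hw i (Finset.mem_range.mp hi) x hx
      rw [inner_sub_right, inner_sub_right] at this
      exact sub_le_iff_le_add'.mp this
  refine ⟨_, hFc, hF, fun t => ?_, ?_⟩
  · obtain ⟨i, hi, h⟩ := Finset.exists_mem_eq_inf' hne fun i => stepLine c w v i t
    exact ⟨i, Finset.mem_range.mp hi, h⟩
  · rw [← sum_integral_steps c k v hFc]
    refine Finset.sum_congr rfl fun i hi => ?_
    rw [← integral_stepLine hv (Finset.mem_range.mp hi)]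
    refine intervalIntegral.integral_congr fun t ht => ?_
    rw [Set.uIcc_of_le (hv.step i (Finset.mem_range.mp hi)).2.le] at ht
    exact le_antisymm (stepLine_le
      (F := fun t => (Finset.range k).inf' hne fun i => stepLine c w v i t) hP hv hF
      (Finset.mem_range.mp hi) ht) (Finset.inf'_le _ hi)

theorem IsCoherent.inner_pathPoint_le (hP : Convex ℝ P) (hv : IsMonotonePath P c k v)
    (hw : IsCoherent P c w k v) {k' : ℕ} {v' : ℕ → E d} (hv' : IsMonotonePath P c k' v') :
    (inner ℝ w (pathPoint c k' v') : ℝ) ≤ inner ℝ w (pathPoint c k v) := by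
  by_cases hk : k = 0
  · have hk' : k' = 0 := by
      rw [hv'.eq_zero_iff, ← hv.inner_start_eq hv', ← hv.inner_end_eq hv']
      exact hv.eq_zero_iff.mp hk
    simp [pathPoint, hk, hk']
  obtain ⟨F, hFc, hF, -, harea⟩ := hw.exists_upper_boundary hP hv hk
  rw [inner_pathPoint, inner_pathPoint, harea]
  have h0 := hv.inner_start_eq hv'
  have h1 := hv.inner_end_eq hv'
  have hden : (inner ℝ c (v' k' - v' 0) : ℝ) = inner ℝ c (v k - v 0) := by
    rw [inner_sub_right, inner_sub_right, h0, h1]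
  rw [hden, h0, h1, ← sum_integral_steps c k' v' hFc]
  refine div_le_div_of_nonneg_right (Finset.sum_le_sum fun i hi =>
    area_step_le hP hv' hFc hF (Finset.mem_range.mp hi)) ?_
  rw [inner_sub_right]
  exact sub_nonneg.mpr (hv.start_min (hv.mem le_rfl))

/-- A path whose point maximizes `w` is itself coherent: the areas below both images can agree only
if the second path also runs along the upper boundary. -/
theorem IsCoherent.of_inner_pathPoint_le (hP : Convex ℝ P) (hv : IsMonotonePath P c k v)
    (hw : IsCoherent P c w k v) {k' : ℕ} {v' : ℕ → E d} (hv' : IsMonotonePath P c k' v')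
    (hle : (inner ℝ w (pathPoint c k v) : ℝ) ≤ inner ℝ w (pathPoint c k' v')) :
    IsCoherent P c w k' v' := by
  have h0 := hv.inner_start_eq hv'
  have h1 := hv.inner_end_eq hv'
  by_cases hk : k = 0
  · have hk' : k' = 0 := by
      rw [hv'.eq_zero_iff, ← h0, ← h1]
      exact hv.eq_zero_iff.mp hk
    intro i hi
    omega
  obtain ⟨F, hFc, hF, hFline, harea⟩ := hw.exists_upper_boundary hP hv hk
  have hden : (inner ℝ c (v' k' - v' 0) : ℝ) = inner ℝ c (v k - v 0) := by
    rw [inner_sub_right, inner_sub_right, h0, h1]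
  have hpos : 0 < (inner ℝ c (v k - v 0) : ℝ) := by
    rw [inner_sub_right]
    exact sub_pos.mpr (hv.inner_lt (Nat.pos_of_ne_zero hk) le_rfl)
  rw [inner_pathPoint, inner_pathPoint, harea, hden, div_le_div_iff_of_pos_right hpos, h0, h1,
    ← sum_integral_steps c k' v' hFc] at hle
  have hsteps : ∀ i ∈ Finset.range k', _ ≤ _ := fun i hi =>
    area_step_le hP hv' hFc hF (Finset.mem_range.mp hi)
  have heq := (Finset.sum_eq_sum_iff_of_le hsteps).mp (le_antisymm (Finset.sum_le_sum hsteps) hle)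
  intro i hi x hx
  have hstep := (hv'.step i hi).2
  have hmid : F ((inner ℝ c (v' i) + inner ℝ c (v' (i + 1))) / 2) =
      stepLine c w v' i ((inner ℝ c (v' i) + inner ℝ c (v' (i + 1))) / 2) := by
    have hmem : (inner ℝ c (v' i) + inner ℝ c (v' (i + 1))) / 2 ∈
        Set.Icc (inner ℝ c (v' i) : ℝ) (inner ℝ c (v' (i + 1))) := by
      constructor <;> linarith
    by_contra hne
    have hlt := intervalIntegral.integral_lt_integral_of_continuousOn_of_le_of_exists_lt hstep
      (continuous_stepLine c w v' i).continuousOn hFc.continuousOn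
      (fun t ht => stepLine_le hP hv' hF hi (Set.Ioc_subset_Icc_self ht))
      ⟨_, hmem, lt_of_le_of_ne (stepLine_le hP hv' hF hi hmem) (Ne.symm hne)⟩
    rw [integral_stepLine hv' hi, heq i (Finset.mem_range.mpr hi)] at hlt
    exact lt_irrefl _ hlt
  -- The supporting line that touches the step at its midpoint contains the whole step.
  obtain ⟨j, hj, hFj⟩ := hFline ((inner ℝ c (v' i) + inner ℝ c (v' (i + 1))) / 2)
  rw [hmid] at hFj
  have ha := hw j hj _ (hv'.mem hi.le)
  have hb := hw j hj _ (hv'.mem (Nat.succ_le_of_lt hi))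
  have hxj := hw j hj x hx
  have hsl := slope_mul (w := w) (hv'.step_pos hi)
  have hpos' := hv'.step_pos hi
  simp only [stepLine] at hFj
  simp only [inner_sub_right] at ha hb hxj hsl hpos' ⊢
  have hslope : slope c w (v' (i + 1) - v' i) = slope c w (v (j + 1) - v j) := by
    apply mul_right_cancel₀ hpos'.ne'
    linarith
  rw [hslope] at hsl hFj ⊢
  linarith

end Path

/-! ### Arborescences -/

theorem slope_smul {c w x : E d} {r : ℝ} (hr : r ≠ 0) : slope c w (r • x) = slope c w x := by
  rw [slope, slope, real_inner_smul_right, real_inner_smul_right, mul_div_mul_left _ _ hr]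

/-- An arborescence has maximal slopes for `w` if it selects, at each non-optimal vertex, an
improving edge of largest slope; these are the choices of the max-slope pivot rule. -/
def IsMaxSlope (P : Set (E d)) (c w : E d) (a : vertices P → vertices P) : Prop :=
  ∀ v : vertices P, ¬ IsOptimal P c v → ∀ u ∈ improvingNeighbors P c v,
    slope c w (u - v) ≤ slope c w (a v - v)

/-- The number of steps from `v₀` to an optimal vertex along the arborescence `a`. The infimum is
attained by `exists_isOptimal_iterate`. -/
noncomputable def lengthFrom (P : Set (E d)) (c : E d) (a : vertices P → vertices P)
    (v₀ : vertices P) : ℕ :=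
  sInf {k | IsOptimal P c (a^[k] v₀ : vertices P)}

/-- The path in `P` that starts at `v₀` and follows the map `a`. -/
def pathFrom {P : Set (E d)} (a : vertices P → vertices P) (v₀ : vertices P) (n : ℕ) : E d :=
  (a^[n] v₀ : vertices P)

section Arborescence

variable {P : Set (E d)} {c w : E d} {a : vertices P → vertices P} {v₀ : vertices P}

theorem improvingNeighbors_subset (P : Set (E d)) (c v : E d) :
    improvingNeighbors P c v ⊆ vertices P := fun _ hu => hu.1.1

theorem isArborescence_of_forall
    (h : ∀ v : vertices P, IsOptimal P c v ∧ a v = v ∨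
      ¬ IsOptimal P c v ∧ (a v : E d) ∈ improvingNeighbors P c v) : IsArborescence P c a where
  fixed_iff v := by
    rcases h v with ⟨h1, h2⟩ | ⟨h1, h2⟩
    · exact ⟨fun _ => h1, fun _ => h2⟩
    · refine ⟨fun hav => absurd (congrArg Subtype.val hav) h2.1.2.2.1, fun h => absurd h h1⟩
  improving v hv := by
    rcases h v with ⟨h1, -⟩ | ⟨-, h2⟩
    · exact absurd h1 hv
    · exact h2

/-- Arborescences may be chosen vertex by vertex. -/
theorem exists_isArborescence (p : vertices P → E d → Prop)
    (h : ∀ v : vertices P, ¬ IsOptimal P c v → ∃ u ∈ improvingNeighbors P c v, p v u) :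
    ∃ a : vertices P → vertices P, IsArborescence P c a ∧
      ∀ v : vertices P, ¬ IsOptimal P c v → p v (a v) := by
  have h' : ∀ v : vertices P, ∃ u : vertices P, (IsOptimal P c v ∧ u = v) ∨
      (¬ IsOptimal P c v ∧ (u : E d) ∈ improvingNeighbors P c v ∧ p v u) := fun v => by
    by_cases hv : IsOptimal P c v
    · exact ⟨v, Or.inl ⟨hv, rfl⟩⟩
    · obtain ⟨u, hu, hp⟩ := h v hv
      exact ⟨⟨u, improvingNeighbors_subset P c v hu⟩, Or.inr ⟨hv, hu, hp⟩⟩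
  choose a ha using h'
  refine ⟨a, isArborescence_of_forall fun v => (ha v).imp id fun h => ⟨h.1, h.2.1⟩, ?_⟩
  intro v hv
  exact ((ha v).resolve_left fun h => hv h.1).2.2

theorem IsPolytope.exists_isMaxSlope (hP : IsPolytope P) (c w : E d) :
    ∃ a : vertices P → vertices P, IsArborescence P c a ∧ IsMaxSlope P c w a :=
  exists_isArborescence (P := P) (c := c)
    (fun v u => ∀ x ∈ improvingNeighbors P c v, slope c w (x - v) ≤ slope c w (u - v))
    fun v hv => Set.exists_max_image _ (fun u => slope c w (u - v))
      (hP.finite_vertices.subset (improvingNeighbors_subset P c v))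
      (hP.exists_improvingNeighbor v.2 hv)

theorem inner_arborescencePoint (hP : IsPolytope P) (c w : E d) (a : vertices P → vertices P) :
    (inner ℝ w (arborescencePoint P (fun x => inner ℝ c x) a) : ℝ) =
      ∑ᶠ v : vertices P, slope c w (a v - v) := by
  have := hP.finite_vertices.fintype
  rw [arborescencePoint, finsum_eq_sum_of_fintype, finsum_eq_sum_of_fintype, inner_sum]
  refine Finset.sum_congr rfl fun v _ => ?_
  rw [real_inner_smul_right, slope, inv_mul_eq_div]

theorem IsMaxSlope.inner_arborescencePoint_le (hP : IsPolytope P) (ha : IsArborescence P c a)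
    (hw : IsMaxSlope P c w a) {b : vertices P → vertices P} (hb : IsArborescence P c b) :
    (inner ℝ w (arborescencePoint P (fun x => inner ℝ c x) b) : ℝ) ≤
      inner ℝ w (arborescencePoint P (fun x => inner ℝ c x) a) := by
  have := hP.finite_vertices.fintype
  rw [inner_arborescencePoint hP, inner_arborescencePoint hP, finsum_eq_sum_of_fintype,
    finsum_eq_sum_of_fintype]
  refine Finset.sum_le_sum fun v _ => ?_
  by_cases hv : IsOptimal P c v
  · rw [(ha.fixed_iff v).mpr hv, (hb.fixed_iff v).mpr hv]
  · exact hw v hv _ (hb.improving v hv)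

/-- An arborescence whose point maximizes `w` has maximal slopes, as otherwise it could be improved
at a single vertex. -/
theorem isMaxSlope_of_forall_inner_le (hP : IsPolytope P) (ha : IsArborescence P c a)
    (h : ∀ b, IsArborescence P c b →
      (inner ℝ w (arborescencePoint P (fun x => inner ℝ c x) b) : ℝ) ≤
        inner ℝ w (arborescencePoint P (fun x => inner ℝ c x) a)) : IsMaxSlope P c w a := by
  classical
  have := hP.finite_vertices.fintype
  intro v hv u hu
  set u' : vertices P := ⟨u, improvingNeighbors_subset P c v hu⟩ with hu'
  have hb : IsArborescence P c (Function.update a v u') := isArborescence_of_forall fun x => by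
    by_cases hx : x = v
    · subst hx
      exact Or.inr ⟨hv, by simpa using hu⟩
    · rw [Function.update_of_ne hx]
      by_cases hxo : IsOptimal P c x
      · exact Or.inl ⟨hxo, (ha.fixed_iff x).mpr hxo⟩
      · exact Or.inr ⟨hxo, ha.improving x hxo⟩
  have hle := h _ hb
  rw [inner_arborescencePoint hP, inner_arborescencePoint hP, finsum_eq_sum_of_fintype,
    finsum_eq_sum_of_fintype, ← Finset.add_sum_erase _ _ (Finset.mem_univ v),
    ← Finset.add_sum_erase _ (fun x : vertices P => slope c w (a x - x)) (Finset.mem_univ v),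
    Finset.sum_congr rfl (fun x hx => by
      rw [Function.update_of_ne (Finset.ne_of_mem_erase hx)]),
    add_le_add_iff_right, Function.update_self] at hle
  exact hle

/-- Following an arborescence leads to an optimal vertex, as `c` increases until then. -/
theorem exists_isOptimal_iterate (hP : IsPolytope P) (ha : IsArborescence P c a)
    (v₀ : vertices P) : ∃ k, IsOptimal P c (a^[k] v₀ : vertices P) := by
  by_contra! hcon
  have := hP.finite_vertices.to_subtype
  have hmono : StrictMono fun n => (inner ℝ c (a^[n] v₀ : E d) : ℝ) :=
    strictMono_nat_of_lt_succ fun n => by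
      rw [Function.iterate_succ_apply']
      exact (ha.improving _ (hcon n)).2
  have hinj : Function.Injective fun n => a^[n] v₀ := fun m n hmn => hmono.injective (by
    dsimp only at hmn ⊢
    rw [hmn])
  exact not_injective_infinite_finite _ hinj

theorem isOptimal_lengthFrom (hP : IsPolytope P) (ha : IsArborescence P c a)
    (v₀ : vertices P) : IsOptimal P c (pathFrom a v₀ (lengthFrom P c a v₀)) :=
  Nat.sInf_mem (exists_isOptimal_iterate hP ha v₀)

theorem not_isOptimal_of_lt_lengthFrom {i : ℕ} (hi : i < lengthFrom P c a v₀) :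
    ¬ IsOptimal P c (a^[i] v₀ : vertices P) :=
  Nat.notMem_of_lt_sInf hi

theorem pathFrom_succ (a : vertices P → vertices P) (v₀ : vertices P) (i : ℕ) :
    pathFrom a v₀ (i + 1) = a (a^[i] v₀) := by
  rw [pathFrom, Function.iterate_succ_apply']

theorem IsArborescence.isMonotonePath (hP : IsPolytope P) (ha : IsArborescence P c a)
    (hv₀ : IsPessimal P c v₀) :
    IsMonotonePath P c (lengthFrom P c a v₀) (pathFrom a v₀) where
  start_mem := v₀.2
  start_min := hv₀
  step i hi := by
    rw [pathFrom_succ]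
    exact ha.improving _ (not_isOptimal_of_lt_lengthFrom hi)
  end_max := isOptimal_lengthFrom hP ha v₀

theorem IsMaxSlope.isGreedy (hw : IsMaxSlope P c w a) (v₀ : vertices P) :
    IsGreedy P c w (lengthFrom P c a v₀) (pathFrom a v₀) := by
  intro i hi u hu
  rw [pathFrom_succ]
  exact hw _ (not_isOptimal_of_lt_lengthFrom hi) u hu

/-- Every monotone path follows some arborescence. -/
theorem IsMonotonePath.exists_isArborescence (hP : IsPolytope P) {k : ℕ} {v : ℕ → E d}
    (hv : IsMonotonePath P c k v) (hv₀ : (v₀ : E d) = v 0) :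
    ∃ a, IsArborescence P c a ∧
      pathPoint c k v = pathPoint c (lengthFrom P c a v₀) (pathFrom a v₀) := by
  have hnotopt : ∀ i < k, ¬ IsOptimal P c (v i) := fun i hi hopt =>
    (hopt (hv.mem (Nat.succ_le_of_lt hi))).not_gt (hv.step i hi).2
  obtain ⟨a, ha, hav⟩ := PivotPolytopes.exists_isArborescence (P := P) (c := c)
    (fun x u => ∀ i < k, v i = x → u = v (i + 1)) (fun x hx => by
      by_cases hex : ∃ i < k, v i = x
      · obtain ⟨i, hi, hix⟩ := hex
        refine ⟨v (i + 1), hix ▸ hv.step i hi, fun j hj hjx => ?_⟩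
        have hval : (inner ℝ c (v i) : ℝ) = inner ℝ c (v j) := by rw [hix, hjx]
        rcases lt_trichotomy i j with hij | rfl | hij
        · exact absurd hval (hv.inner_lt hij hj.le).ne
        · rfl
        · exact absurd hval (hv.inner_lt hij hi.le).ne'
      · obtain ⟨u, hu⟩ := hP.exists_improvingNeighbor x.2 hx
        exact ⟨u, hu, fun i hi hix => absurd ⟨i, hi, hix⟩ hex⟩)
  have hpath : ∀ i ≤ k, pathFrom a v₀ i = v i := by
    intro i
    induction i with
    | zero => exact fun _ => hv₀
    | succ i ih =>
      intro hi
      have hii := ih (Nat.le_of_succ_le hi)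
      rw [pathFrom_succ]
      exact hav _ (fun h => hnotopt i hi (hii ▸ h)) i hi hii.symm
  have hlen : lengthFrom P c a v₀ = k := by
    refine le_antisymm (Nat.sInf_le ?_) (not_lt.mp fun hlt => ?_)
    · change IsOptimal P c (pathFrom a v₀ k)
      rw [hpath k le_rfl]
      exact hv.end_max
    · have := isOptimal_lengthFrom hP ha v₀
      rw [hpath _ hlt.le] at this
      exact hnotopt _ hlt this
  refine ⟨a, ha, ?_⟩
  rw [hlen, pathPoint, pathPoint, hpath k le_rfl, hpath 0 (Nat.zero_le k)]
  refine Finset.sum_congr rfl fun i hi => ?_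
  rw [hpath _ (Finset.mem_range.mp hi).le, hpath _ (Finset.mem_range.mp hi)]

theorem maxSlopePivotRulePolytope_eq (P : Set (E d)) (c : E d) :
    maxSlopePivotRulePolytope P c = convexHull ℝ (Set.range
      fun a : {a // IsArborescence P c a} => arborescencePoint P (fun x => inner ℝ c x) a.1) := by
  rw [maxSlopePivotRulePolytope, pivotRulePolytope]
  congr 1
  ext x
  constructor
  · rintro ⟨a, ha, rfl⟩
    exact ⟨⟨a, ha⟩, rfl⟩
  · rintro ⟨a, rfl⟩
    exact ⟨a.1, a.2, rfl⟩

theorem monotonePathPolytope_eq (hP : IsPolytope P) (hc : IsGeneric P c)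
    (hv₀ : IsPessimal P c v₀) :
    monotonePathPolytope P c = convexHull ℝ (Set.range
      fun a : {a // IsArborescence P c a} =>
        pathPoint c (lengthFrom P c a.1 v₀) (pathFrom a.1 v₀)) := by
  rw [monotonePathPolytope]
  congr 1
  ext x
  constructor
  · rintro ⟨k, v, hv, rfl⟩
    obtain ⟨a, ha, h⟩ := hv.exists_isArborescence (v₀ := v₀) hP
      (hP.eq_of_isPessimal hc hv.start_mem hv.start_min (vertices_subset P v₀.2) hv₀)
    exact ⟨⟨a, ha⟩, h.symm⟩
  · rintro ⟨a, rfl⟩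
    exact ⟨_, _, a.2.isMonotonePath hP hv₀, rfl⟩

/-- If every arborescence `a` has a companion that has maximal slopes whenever the path along `a`
is coherent, then the max-slope pivot rule polytope is a summand of the monotone path polytope. -/
theorem isWeakMinkowskiSummand_maxSlopePivotRulePolytope (hP : IsPolytope P) (hc : IsGeneric P c)
    (h : ∀ (k : ℕ) (v : ℕ → E d), IsMonotonePath P c k v → ∃ b, IsArborescence P c b ∧
      ∀ w, IsCoherent P c w k v → IsMaxSlope P c w b) :
    IsWeakMinkowskiSummand (maxSlopePivotRulePolytope P c) (monotonePathPolytope P c) := by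
  obtain ⟨v₀, hv₀V, hv₀⟩ := hP.exists_isPessimal c
  lift v₀ to vertices P using hv₀V
  have := hP.finite_vertices.to_subtype
  have : Nonempty {a // IsArborescence P c a} :=
    let ⟨a, ha, _⟩ := hP.exists_isMaxSlope c 0
    ⟨⟨a, ha⟩⟩
  have hpath := fun a : {a // IsArborescence P c a} => a.2.isMonotonePath hP hv₀
  choose b hb hbw using fun a : {a // IsArborescence P c a} => h _ _ (hpath a)
  have hcoh : ∀ (a : {a // IsArborescence P c a}) (w : E d), IsMaxSlope P c w a.1 →
      IsCoherent P c w (lengthFrom P c a.1 v₀) (pathFrom a.1 v₀) := fun a w hw =>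
    (hw.isGreedy v₀).isCoherent hP hc (hpath a)
  have heq : maxSlopePivotRulePolytope P c = convexHull ℝ (Set.range
      fun a : {a // IsArborescence P c a} =>
        arborescencePoint P (fun x => inner ℝ c x) (b a)) := by
    rw [maxSlopePivotRulePolytope_eq]
    refine Set.Subset.antisymm (convexHull_range_subset _ _ fun w j => ?_) (convexHull_mono ?_)
    · obtain ⟨a, ha, haw⟩ := hP.exists_isMaxSlope c w
      exact ⟨⟨a, ha⟩, (hbw ⟨a, ha⟩ w (hcoh ⟨a, ha⟩ w haw)).inner_arborescencePoint_le hP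
        (hb ⟨a, ha⟩) j.2⟩
    · rintro _ ⟨a, rfl⟩
      exact ⟨⟨b a, hb a⟩, rfl⟩
  rw [heq, monotonePathPolytope_eq hP hc hv₀]
  refine isWeakMinkowskiSummand_convexHull_range _ _ fun i w hi j => ?_
  obtain ⟨a, ha, haw⟩ := hP.exists_isMaxSlope c w
  exact (hbw i w ((hcoh ⟨a, ha⟩ w haw).of_inner_pathPoint_le hP.convex (hpath ⟨a, ha⟩) (hpath i)
    (hi ⟨a, ha⟩))).inner_arborescencePoint_le hP (hb i) (hb j)

theorem isWeakMinkowskiSummand_monotonePathPolytope (hP : IsPolytope P) (hc : IsGeneric P c) :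
    IsWeakMinkowskiSummand (monotonePathPolytope P c) (maxSlopePivotRulePolytope P c) := by
  obtain ⟨v₀, hv₀V, hv₀⟩ := hP.exists_isPessimal c
  lift v₀ to vertices P using hv₀V
  have := hP.finite_vertices.to_subtype
  have : Nonempty {a // IsArborescence P c a} :=
    let ⟨a, ha, _⟩ := hP.exists_isMaxSlope c 0
    ⟨⟨a, ha⟩⟩
  rw [maxSlopePivotRulePolytope_eq, monotonePathPolytope_eq hP hc hv₀]
  refine isWeakMinkowskiSummand_convexHull_range _ _ fun a w ha b => ?_
  have hw : IsMaxSlope P c w a.1 := isMaxSlope_of_forall_inner_le hP a.2 fun b hb => ha ⟨b, hb⟩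
  have hpath := a.2.isMonotonePath hP hv₀
  exact ((hw.isGreedy v₀).isCoherent hP hc hpath).inner_pathPoint_le hP.convex hpath
    (b.2.isMonotonePath hP hv₀)

end Arborescence

/-! ### Zonotopes -/

section Zonotope

variable {P : Set (E d)} {n : ℕ} {t : E d} {z : Fin n → E d}

theorem mem_zonotope_iff (hz : {-t} + P = ∑ i, segment ℝ (-(z i)) (z i)) {x : E d} :
    x ∈ P ↔ ∃ ε : Fin n → ℝ, (∀ i, ε i ∈ Set.Icc (-1) 1) ∧ x = t + ∑ i, ε i • z i := by
  have hx : x ∈ P ↔ -t + x ∈ {-t} + P := by simp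
  rw [hx, hz, Set.mem_fintype_sum]
  constructor
  · rintro ⟨g, hg, hsum⟩
    have : ∀ i, ∃ e : ℝ, e ∈ Set.Icc (-1 : ℝ) 1 ∧ g i = e • z i := fun i => by
      obtain ⟨a, b, ha, hb, hab, h⟩ := hg i
      refine ⟨b - a, ⟨by linarith, by linarith⟩, ?_⟩
      rw [← h]
      module
    choose ε hε hgε using this
    refine ⟨ε, hε, ?_⟩
    simp only [← hgε, hsum, add_neg_cancel_left]
  · rintro ⟨ε, hε, rfl⟩
    refine ⟨fun i => ε i • z i, fun i => ?_, by simp⟩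
    refine ⟨(1 - ε i) / 2, (1 + ε i) / 2, by linarith [(hε i).2], by linarith [(hε i).1],
      by ring, ?_⟩
    module

theorem add_smul_generator_mem (hz : {-t} + P = ∑ i, segment ℝ (-(z i)) (z i))
    {ε : Fin n → ℝ} (hε : ∀ i, ε i ∈ Set.Icc (-1) 1) (k : Fin n) {s : ℝ}
    (hs : ε k + s ∈ Set.Icc (-1) 1) : (t + ∑ i, ε i • z i) + s • z k ∈ P := by
  classical
  rw [mem_zonotope_iff hz]
  refine ⟨Function.update ε k (ε k + s), fun i => ?_, ?_⟩
  · by_cases hi : i = k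
    · subst hi; simpa using hs
    · simpa [hi] using hε i
  · rw [← Finset.add_sum_erase _ _ (Finset.mem_univ k),
      ← Finset.add_sum_erase _ (fun i => Function.update ε k (ε k + s) i • z i)
        (Finset.mem_univ k),
      Finset.sum_congr rfl (g := fun i => ε i • z i) (s₂ := Finset.univ.erase k)
        (fun i hi => by rw [Function.update_of_ne (Finset.ne_of_mem_erase hi)] :
          ∀ i ∈ Finset.univ.erase k, Function.update ε k (ε k + s) i • z i = ε i • z i),
      Function.update_self]
    module

/-- A generator whose coefficient changes along an edge of a zonotope is parallel to the edge: the
midpoint of the edge can be moved in both directions of the generator. -/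
theorem IsEdge.sub_eq_smul_generator (hz : {-t} + P = ∑ i, segment ℝ (-(z i)) (z i)) {u v : E d}
    (h : IsEdge P u v) {ε ε' : Fin n → ℝ} (hε : ∀ i, ε i ∈ Set.Icc (-1) 1)
    (hε' : ∀ i, ε' i ∈ Set.Icc (-1) 1) (hu : u = t + ∑ i, ε i • z i)
    (hv : v = t + ∑ i, ε' i • z i) {k : Fin n} (hk : ε k ≠ ε' k) (hzk : z k ≠ 0) :
    ∃ r : ℝ, r ≠ 0 ∧ u - v = r • z k := by
  set η : Fin n → ℝ := fun i => (ε i + ε' i) / 2 with hη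
  have hηI : ∀ i, η i ∈ Set.Icc (-1) 1 := fun i =>
    ⟨by simp only [hη]; linarith [(hε i).1, (hε' i).1],
      by simp only [hη]; linarith [(hε i).2, (hε' i).2]⟩
  have hm : t + ∑ i, η i • z i = (1 / 2 : ℝ) • u + (1 / 2 : ℝ) • v := by
    have : ∀ i, η i • z i = (1 / 2 : ℝ) • (ε i • z i) + (1 / 2 : ℝ) • (ε' i • z i) := fun i => by
      simp only [hη]; module
    simp only [this, Finset.sum_add_distrib, ← Finset.smul_sum, hu, hv]
    module
  obtain ⟨s, hs0, hs1, hs2⟩ : ∃ s : ℝ, 0 < s ∧ η k + s ≤ 1 ∧ -1 ≤ η k - s := by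
    have h1 := hε k
    have h2 := hε' k
    simp only [hη]
    rcases lt_or_gt_of_ne hk with hlt | hlt
    · exact ⟨(ε' k - ε k) / 2, by linarith, by linarith [h1.2, h2.2], by linarith [h1.1, h2.1]⟩
    · exact ⟨(ε k - ε' k) / 2, by linarith, by linarith [h1.2, h2.2], by linarith [h1.1, h2.1]⟩
  have hp := add_smul_generator_mem hz hηI k (s := s) ⟨by linarith, hs1⟩
  have hq := add_smul_generator_mem hz hηI k (s := -s) ⟨by linarith, by linarith⟩
  rw [hm] at hp hq
  obtain ⟨a, b, ha, hb, hab, hab'⟩ := h.2.2.2.left_mem_of_mem_openSegment hp hq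
    (z := (1 / 2 : ℝ) • u + (1 / 2 : ℝ) • v)
    ⟨1 / 2, 1 / 2, by norm_num, by norm_num, by norm_num, rfl⟩
    ⟨1 / 2, 1 / 2, by norm_num, by norm_num, by norm_num, by module⟩
  obtain rfl : b = 1 - a := by linarith
  have hsz : s • z k = (a - 1 / 2) • (u - v) := by
    rw [← sub_eq_iff_eq_add'.mpr hab']
    module
  have ha' : a - 1 / 2 ≠ 0 := fun h0 => by
    rw [h0, zero_smul] at hsz
    exact (smul_ne_zero hs0.ne' hzk) hsz
  refine ⟨(a - 1 / 2)⁻¹ * s, mul_ne_zero (inv_ne_zero ha') hs0.ne', ?_⟩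
  rw [mul_smul, hsz, inv_smul_smul₀ ha']

/-- On a zonotope every monotone path uses all edge directions: the coefficient of a generator that
is not orthogonal to `c` differs at the two ends of the path. -/
theorem IsZonotope.exists_parallel_step (hP : IsZonotope P) {c : E d} {k : ℕ} {v : ℕ → E d}
    (hv : IsMonotonePath P c k v) {x u : E d} (hu : u ∈ improvingNeighbors P c x) :
    ∃ i < k, ∃ r : ℝ, r ≠ 0 ∧ u - x = r • (v (i + 1) - v i) := by
  obtain ⟨n, t, z, hz⟩ := hP
  obtain ⟨ε, hε, hεu⟩ := (mem_zonotope_iff hz).mp (vertices_subset P hu.1.1)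
  obtain ⟨ε', hε', hεx⟩ := (mem_zonotope_iff hz).mp (vertices_subset P hu.1.2.1)
  obtain ⟨j, hj, hzj⟩ : ∃ j, ε j ≠ ε' j ∧ z j ≠ 0 := by
    by_contra! hcon
    refine hu.1.2.2.1 ?_
    rw [hεu, hεx]
    congr 1
    refine Finset.sum_congr rfl fun j _ => ?_
    by_cases hj : ε j = ε' j
    · rw [hj]
    · rw [hcon j hj, smul_zero, smul_zero]
  obtain ⟨r, hr, hux⟩ := hu.1.sub_eq_smul_generator hz hε hε' hεu hεx hj hzj
  have hcz : (inner ℝ c (z j) : ℝ) ≠ 0 := fun h0 => by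
    have h1 : (inner ℝ c (u - x) : ℝ) = 0 := by rw [hux, real_inner_smul_right, h0, mul_zero]
    rw [inner_sub_right, sub_eq_zero] at h1
    exact hu.2.ne' h1
  have hrep : ∀ i, ∃ δ : Fin n → ℝ, i ≤ k → (∀ l, δ l ∈ Set.Icc (-1) 1) ∧
      v i = t + ∑ l, δ l • z l := fun i => by
    by_cases hi : i ≤ k
    · obtain ⟨δ, hδ⟩ := (mem_zonotope_iff hz).mp (hv.mem hi)
      exact ⟨δ, fun _ => hδ⟩
    · exact ⟨0, fun h => absurd h hi⟩
  choose δ hδ using hrep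
  obtain ⟨i, hi, hne⟩ : ∃ i < k, δ (i + 1) j ≠ δ i j := by
    by_contra! hcon
    have hconst : ∀ i ≤ k, δ i j = δ 0 j := fun i => by
      induction i with
      | zero => exact fun _ => rfl
      | succ i ih => exact fun hi => (hcon i hi).trans (ih (Nat.le_of_succ_le hi))
    obtain ⟨hI0, hv0⟩ := hδ 0 (Nat.zero_le k)
    obtain ⟨hIk, hvk⟩ := hδ k le_rfl
    -- Both ends may be moved by the same multiples of `z j`, so these do not change `c`.
    have hmove : ∀ s : ℝ, δ 0 j + s ∈ Set.Icc (-1) 1 → s = 0 := fun s hs => by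
      have h0 := hv.start_min (hv0 ▸ add_smul_generator_mem hz hI0 j hs)
      have hk := hv.end_max (hvk ▸ add_smul_generator_mem hz hIk j (s := s)
        (by rw [hconst k le_rfl]; exact hs))
      simp only [Set.mem_ofPred_eq, inner_add_right, real_inner_smul_right] at h0 hk
      have : s * inner ℝ c (z j) = 0 := le_antisymm (by linarith) (by linarith)
      exact (mul_eq_zero.mp this).resolve_right hcz
    have h1 := hmove (1 - δ 0 j) ⟨by linarith, by linarith⟩
    have h2 := hmove (-1 - δ 0 j) ⟨by linarith, by linarith⟩
    linarith
  obtain ⟨hI, hvi⟩ := hδ i hi.le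
  obtain ⟨hI', hvi'⟩ := hδ (i + 1) hi
  obtain ⟨r', hr', hstep⟩ := (hv.step i hi).1.sub_eq_smul_generator hz hI' hI hvi' hvi hne hzj
  refine ⟨i, hi, r * r'⁻¹, mul_ne_zero hr (inv_ne_zero hr'), ?_⟩
  rw [hstep, mul_smul, inv_smul_smul₀ hr', hux]

/-- On a zonotope a monotone path determines an arborescence that has maximal slopes for every
objective function for which the path is coherent: follow the improving edge whose direction is
the first to occur on the path. -/
theorem IsZonotope.exists_isMaxSlope (hZ : IsZonotope P) (hP : IsPolytope P) {c : E d} {k : ℕ}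
    {v : ℕ → E d} (hv : IsMonotonePath P c k v) :
    ∃ b, IsArborescence P c b ∧ ∀ w, IsCoherent P c w k v → IsMaxSlope P c w b := by
  classical
  obtain ⟨b, hb, hmax⟩ := exists_isArborescence (P := P) (c := c)
    (fun x u => ∀ w, IsCoherent P c w k v → ∀ y ∈ improvingNeighbors P c x,
      slope c w (y - x) ≤ slope c w (u - x)) (fun x hx => by
    have hex : ∃ i, ∃ u ∈ improvingNeighbors P c x,
        i < k ∧ ∃ r : ℝ, r ≠ 0 ∧ u - x = r • (v (i + 1) - v i) := by
      obtain ⟨u, hu⟩ := hP.exists_improvingNeighbor x.2 hx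
      obtain ⟨i, hi, h⟩ := hZ.exists_parallel_step hv hu
      exact ⟨i, u, hu, hi, h⟩
    obtain ⟨u, hu, -, r, hr, hur⟩ := Nat.find_spec hex
    refine ⟨u, hu, fun w hw y hy => ?_⟩
    obtain ⟨j, hj, s, hs, hys⟩ := hZ.exists_parallel_step hv hy
    rw [hur, hys, slope_smul hr, slope_smul hs]
    exact hw.slope_le hv (Nat.find_min' hex ⟨y, hy, hj, s, hs, hys⟩) hj)
  exact ⟨b, hb, fun w hw x hx => hmax x hx w hw⟩

end Zonotope

end PivotPolytopes

theorem theorem1p4 (d : ℕ) (P : Set (PivotPolytopes.E d)) (hP : PivotPolytopes.IsPolytope P)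
    (c : PivotPolytopes.E d) (hc : PivotPolytopes.IsGeneric P c) :
    PivotPolytopes.IsWeakMinkowskiSummand
        (PivotPolytopes.monotonePathPolytope P c)
        (PivotPolytopes.maxSlopePivotRulePolytope P c) ∧
      (PivotPolytopes.IsZonotope P →
        PivotPolytopes.NormallyEquivalent
          (PivotPolytopes.monotonePathPolytope P c)
          (PivotPolytopes.maxSlopePivotRulePolytope P c)) := by
  have h := PivotPolytopes.isWeakMinkowskiSummand_monotonePathPolytope hP hc
  exact ⟨h, fun hZ => ⟨PivotPolytopes.isWeakMinkowskiSummand_maxSlopePivotRulePolytope hP hc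
    fun _ _ hv => hZ.exists_isMaxSlope hP hv, h⟩⟩
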